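/- Let $\mathcal P$ be a finite family of pairwise disjoint simple polygons in the plane (closed regions bounded by simple closed polygonal curves) such that no three distinct vertices lie on a common line. For $\mathcal S\subseteq\mathcal P$ let $\mathrm{CH}(\mathcal S)$ be the convex hull of $\bigcup\mathcal S$. *Definitions.* $\mathcal S$ is *tight* if there is no line that misses all polygons of $\mathcal S$ and has polygons of $\mathcal S$ on both sides. $\mathcal S$ is *bridgeable by* a finite set $\Sigma$ of closed segments with pairwise disjoint relative interiors if: $\bigcup\mathcal S\cup\bigcup\Sigma$ is connected; the relative interiors of the segments of $\Sigma$ are disjoint from the interiors of the polygons of $\mathcal P$; every polygon of $\mathcal P$ that meets a segment of $\Sigma$ belongs to $\mathcal S$; every segment of $\Sigma$ has an endpoint on the boundary of a polygon of $\mathcal S$; and every segment of $\Sigma$ lies in $\mathrm{CH}(\mathcal S)$. $\mathcal S$ is *bridgeable* if it is bridgeable by some $\Sigma$. A partition of $\mathcal P$ is *proper* if all its sets are tight and bridgeable. Bridgeable sets $\mathcal S_1,\mathcal S_2$ are *compatible* if they are disjoint, they are bridgeable by some $\Sigma_1$, $\Sigma_2$ such that every segment of $\Sigma_1$ is disjoint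 from every segment of $\Sigma_2$, and $\mathcal S_1\cup\mathcal S_2$ is bridgeable. *Algorithm (main stage).* It maintains a partition of $\mathcal P$, initially into singletons; a scene, initially the polygons; and a FIFO queue of edges, initially the edges of the hulls $\mathrm{CH}(\{P\})$, $P\in\mathcal P$, that are not edges of $P$ (in any order). While the queue is non-empty, it pops its front edge, calls the endpoints $p_1\in P_1$ and $p_2\in P_2$ (in either order; $P_1,P_2\in\mathcal P$), and shoots a ray from $p_1$ towards $p_2$ up to the first point $h\ne p_1$ of the scene. The label $P$ of what is hit is $P_2$ if $h=p_2$, and otherwise a polygon containing $h$ or the label of an earlier shot segment containing $h$. The segment $p_1h$ is added to the scene with label $P_1$. If the sets $X\ni P_1$ and $X'\ni P$ of the partition are different, they are replaced by $X\cup X'$, and the edges of $\mathrm{CH}(X\cup X')$ that are edges neither of $\mathrm{CH}(X)$ nor of $\mathrm{CH}(X')$ are appended to the queue (in any order). *Statement.* Let $\Pi_0,\Pi_1,\dots,\Pi_m$ be the partitions computed by the algorithm up to its $m$-th merge, where $\mathcal S_t,\mathcal S_t'\in\Pi_t$ are the two sets merged to obtain $\Pi_{t+1}$, for $t=0,\dots,m-1$.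 Then for every $t<m$: (A) $\mathrm{CH}(\mathcal S_t)$ intersects $\mathrm{CH}(\mathcal S_t')$; (B) $\mathcal S_t$ and $\mathcal S_t'$ are compatible; (C) $\Pi_{t+1}$ is proper. Moreover $\Pi_0$ is proper, and for every $t\le m$, at the moment when $\Pi_t$ appears, every $\mathcal S\in\Pi_t$ is bridgeable by the set of the segments shot so far whose label belongs to $\mathcal S$. -/

import Mathlib

namespace Convexify

/-- The Euclidean plane. -/
abbrev Plane := EuclideanSpace ℝ (Fin 2)

/-- A simple polygon, given by the cyclic sequence of its vertices: the half-open edges, run through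
one after another, form an injective closed curve. -/
structure SimplePolygon where
  n : ℕ
  three_le : 3 ≤ n
  poly : Polygon Plane n
  simple : ∀ i j : Fin n, ∀ s ∈ Set.Ico (0 : ℝ) 1, ∀ t ∈ Set.Ico (0 : ℝ) 1,
    poly.edgePath ℝ i s = poly.edgePath ℝ j t → i = j ∧ s = t

namespace SimplePolygon

/-- The boundary curve, the union of the edges. -/
def boundary (Q : SimplePolygon) : Set Plane := Q.poly.boundary ℝ

/-- The closed region bounded by the boundary curve: the curve together with the bounded
components of its complement. -/
def region (Q : SimplePolygon) : Set Plane :=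
  Q.boundary ∪ {x | x ∉ Q.boundary ∧ Bornology.IsBounded (connectedComponentIn Q.boundaryᶜ x)}

/-- The set of vertices. -/
def vertexSet (Q : SimplePolygon) : Set Plane := Set.range Q.poly.vertices

/-- The points `p`, `q` are the endpoints of an edge of the polygon. -/
def IsEdge (Q : SimplePolygon) (p q : Plane) : Prop :=
  ∃ i : Fin Q.n, s(p, q) = s(Q.poly.vertices i, Q.poly.vertices (finRotate Q.n i))

end SimplePolygon

section Geometry

variable {ι : Type*} (P : ι → SimplePolygon)

/-- No three distinct vertices of the polygons lie on a common line. -/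
def GeneralPosition : Prop :=
  ∀ a ∈ ⋃ i, (P i).vertexSet, ∀ b ∈ ⋃ i, (P i).vertexSet, ∀ c ∈ ⋃ i, (P i).vertexSet,
    a ≠ b → a ≠ c → b ≠ c → ¬ Collinear ℝ {a, b, c}

/-- The union of the polygons with index in `S`. -/
def polyUnion (S : Set ι) : Set Plane := ⋃ i ∈ S, (P i).region

/-- The combined convex hull of the polygons with index in `S`. -/
def hull (S : Set ι) : Set Plane := convexHull ℝ (polyUnion P S)

/-- Some line `{x | ⟪a, x⟫ = c}` misses all polygons of `S` and has polygons of `S` on both sides. -/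
def Separable (S : Set ι) : Prop :=
  ∃ (a : Plane) (c : ℝ), a ≠ 0 ∧ (∀ i ∈ S, ∀ x ∈ (P i).region, inner ℝ a x ≠ c) ∧
    (∃ i ∈ S, ∀ x ∈ (P i).region, inner ℝ a x < c) ∧
    (∃ j ∈ S, ∀ x ∈ (P j).region, c < inner ℝ a x)

/-- A set of polygons is tight if it is not separable. -/
def Tight (S : Set ι) : Prop := ¬ Separable P S

/-- The set `S` of polygons is bridgeable by the finite set `B` of closed segments; a segment is
given by the pair of its endpoints. -/
structure BridgeableBy (S : Set ι) (B : Set (Plane × Plane)) : Prop where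
  finite : B.Finite
  nondegenerate : ∀ b ∈ B, b.1 ≠ b.2
  interior_disjoint : B.Pairwise fun b c =>
    Disjoint (openSegment ℝ b.1 b.2) (openSegment ℝ c.1 c.2)
  connected : IsConnected (polyUnion P S ∪ ⋃ b ∈ B, segment ℝ b.1 b.2)
  interior_disjoint_polygon : ∀ b ∈ B, ∀ i,
    Disjoint (openSegment ℝ b.1 b.2) (interior (P i).region)
  mem_of_meets : ∀ b ∈ B, ∀ i, (segment ℝ b.1 b.2 ∩ (P i).region).Nonempty → i ∈ S
  endpoint : ∀ b ∈ B, ∃ i ∈ S, b.1 ∈ (P i).boundary ∨ b.2 ∈ (P i).boundary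
  subset_hull : ∀ b ∈ B, segment ℝ b.1 b.2 ⊆ hull P S

/-- The set `S` of polygons is bridgeable by some set of segments. -/
def Bridgeable (S : Set ι) : Prop := ∃ B, BridgeableBy P S B

/-- A partition of the polygons is proper if all its sets are tight and bridgeable. -/
def Proper (part : Set (Set ι)) : Prop :=
  Setoid.IsPartition part ∧ ∀ S ∈ part, Tight P S ∧ Bridgeable P S

/-- Compatibility of two bridgeable sets of polygons. -/
def Compatible (S T : Set ι) : Prop :=
  Disjoint S T ∧
  (∃ B C, BridgeableBy P S B ∧ BridgeableBy P T C ∧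
    ∀ b ∈ B, ∀ c ∈ C, Disjoint (segment ℝ b.1 b.2) (segment ℝ c.1 c.2)) ∧
  Bridgeable P (S ∪ T)

end Geometry

/-- The points `p`, `q` are the endpoints of an edge (a one-dimensional face) of the convex polygon
`K`. -/
def IsHullEdge (K : Set Plane) (p q : Plane) : Prop :=
  p ≠ q ∧ IsExtreme ℝ K (segment ℝ p q)

/-- The trace of a ray: the ray started at the vertex `src` of the polygon `label` and stopped
at `dst`. -/
structure Trace (ι : Type*) where
  src : Plane
  dst : Plane
  label : ι

/-- A state of the main loop: the current partition of the polygons (the union-find structure; the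
maintained convex polygons are the hulls of its sets), the traces inserted into the scene so far,
and the queue of edges that are still to be traced. -/
structure State (ι : Type*) where
  part : Set (Set ι)
  traces : Set (Trace ι)
  queue : List (Sym2 Plane)

/-- The segments traced by the rays that were shot from polygons of `S`. -/
def State.segmentsOf {ι : Type*} (s : State ι) (S : Set ι) : Set (Plane × Plane) :=
  {b | ∃ τ ∈ s.traces, τ.label ∈ S ∧ b = (τ.src, τ.dst)}

section Algorithm

variable {ι : Type*} (P : ι → SimplePolygon)

/-- The scene of the ray shooting structure: the polygons and the traces of the earlier rays. -/
def scene (s : State ι) : Set Plane :=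
  (⋃ i, (P i).region) ∪ ⋃ τ ∈ s.traces, segment ℝ τ.src τ.dst

/-- The initial states: singletons, no traces, and a queue that lists (in any order, each once) the
edges of the convex hulls of the single polygons that are not edges of the polygon itself. -/
structure IsInitial (s : State ι) : Prop where
  part_eq : s.part = Set.range fun i => ({i} : Set ι)
  traces_eq : s.traces = ∅
  queue_nodup : s.queue.Nodup
  mem_queue : ∀ p q, s(p, q) ∈ s.queue ↔ ∃ i, IsHullEdge (hull P {i}) p q ∧ ¬ (P i).IsEdge p q

/-- In state `s`, the ray shot from the point `p` of the polygon `i` towards `q` stops at `h`, and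
the entity it hits carries the label `k`: this is the polygon of `q` if the ray arrives at `q`;
otherwise it is a polygon containing `h` or the label of an older trace through `h`. -/
structure Shoots (s : State ι) (p q h : Plane) (i k : ι) : Prop where
  source : p ∈ (P i).region
  mem_segment : h ∈ segment ℝ p q
  ne_source : h ≠ p
  clear : Disjoint (openSegment ℝ p h) (scene P s)
  hit : (h = q ∧ q ∈ (P k).region) ∨
    (h ≠ q ∧ (h ∈ (P k).region ∨
      ∃ τ ∈ s.traces, h ∈ segment ℝ τ.src τ.dst ∧ τ.label = k))

/-- One iteration without a merge: the edge at the front of the queue is popped, a ray is shot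
along it from one of its endpoints, its trace is inserted, and it hit its own component. -/
def IdleStep (s s' : State ι) : Prop :=
  ∃ (p q h : Plane) (i k : ι) (rest : List (Sym2 Plane)),
    s.queue = s(p, q) :: rest ∧ Shoots P s p q h i k ∧
    (∃ X ∈ s.part, i ∈ X ∧ k ∈ X) ∧
    s' = ⟨s.part, insert ⟨p, h, i⟩ s.traces, rest⟩

/-- One iteration in which a ray shot from the component `X` hits the different component `X'`: the
two are merged, and the new edges of the new convex hull are pushed (in any order, each once). -/
def MergeStep (s : State ι) (X X' : Set ι) (s' : State ι) : Prop :=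
  ∃ (p q h : Plane) (i k : ι) (rest new : List (Sym2 Plane)),
    s.queue = s(p, q) :: rest ∧ Shoots P s p q h i k ∧
    X ∈ s.part ∧ X' ∈ s.part ∧ i ∈ X ∧ k ∈ X' ∧ X ≠ X' ∧
    new.Nodup ∧
    (∀ a b, s(a, b) ∈ new ↔ IsHullEdge (hull P (X ∪ X')) a b ∧
      ¬ IsHullEdge (hull P X) a b ∧ ¬ IsHullEdge (hull P X') a b) ∧
    s' = ⟨(s.part \ {X, X'}) ∪ {X ∪ X'}, insert ⟨p, h, i⟩ s.traces, rest ++ new⟩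

/-- An execution of the main loop up to its `m`-th merge. The state `start t` is the one in which
the `t`-th partition appears; then come iterations without a merge up to the state `finish t`, and
then the iteration that merges the sets `left t` and `right t`. The values at times beyond `m` are
irrelevant. -/
structure Execution (m : ℕ) where
  start : ℕ → State ι
  finish : ℕ → State ι
  left : ℕ → Set ι
  right : ℕ → Set ι
  initial : IsInitial P (start 0)
  idle : ∀ t < m, Relation.ReflTransGen (IdleStep P) (start t) (finish t)
  merge : ∀ t < m, MergeStep P (finish t) (left t) (right t) (start (t + 1))

/-- The `t`-th partition of the sequence that the execution computes. -/
def Execution.partition {P : ι → SimplePolygon} {m : ℕ} (E : Execution P m) (t : ℕ) :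
    Set (Set ι) := (E.start t).part

end Algorithm

end Convexify

open Convexify

/-!
Attach to every block of the partition its polygons together with the traces shot from them. Each
of these sets is connected, and they are pairwise disjoint: a new ray starts in the set of one
block, ends in the set of another (possibly the same) one, and avoids the scene in between, so it
meets only the sets of blocks that are merged. A hull may lose edges by merging, but an edge in the
queue always remains an edge of the hull of some part of a block. Hence it starts at an extreme
point of that hull, which lies on the boundary of a polygon, and the trace along it lies in the
hull of its own block. The point hit therefore belongs to the hulls of both blocks, which makes
their union tight.
-/

namespace Convexify

open Set

section Topology

variable {X : Type*} [TopologicalSpace X]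

theorem closure_connectedComponentIn_inter_subset (F : Set X) (x : X) :
    closure (connectedComponentIn F x) ∩ F ⊆ connectedComponentIn F x := by
  rintro y ⟨hy, hyF⟩
  have hx : x ∈ F := connectedComponentIn_nonempty_iff.1 (closure_nonempty_iff.1 ⟨y, hy⟩)
  have hpre : IsPreconnected (insert y (connectedComponentIn F x)) :=
    isPreconnected_connectedComponentIn.subset_closure (subset_insert _ _)
      (insert_subset hy subset_closure)
  exact hpre.subset_connectedComponentIn (mem_insert_of_mem _ (mem_connectedComponentIn hx))
    (insert_subset hyF (connectedComponentIn_subset F x)) (mem_insert _ _)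

theorem frontier_connectedComponentIn_subset_compl [LocallyConnectedSpace X] {U : Set X}
    (hU : IsOpen U) (x : X) : frontier (connectedComponentIn U x) ⊆ Uᶜ := by
  rintro y ⟨hy, hyint⟩ hyU
  rw [hU.connectedComponentIn.interior_eq] at hyint
  exact hyint (closure_connectedComponentIn_inter_subset U x ⟨hy, hyU⟩)

theorem isConnected_union_connectedComponentIn_compl [PreconnectedSpace X]
    [LocallyConnectedSpace X] {K : Set X} (hK : IsConnected K) (hclosed : IsClosed K) (x : X) :
    IsConnected (K ∪ connectedComponentIn Kᶜ x) := by
  by_cases hx : x ∈ K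
  · rwa [connectedComponentIn_eq_empty (notMem_compl_iff.2 hx), union_empty]
  have hne_univ : connectedComponentIn Kᶜ x ≠ univ := by
    intro huniv
    obtain ⟨a, ha⟩ := hK.nonempty
    exact connectedComponentIn_subset Kᶜ x (huniv ▸ mem_univ a) ha
  obtain ⟨y, hy⟩ : (frontier (connectedComponentIn Kᶜ x)).Nonempty :=
    nonempty_frontier_iff.2 ⟨⟨x, mem_connectedComponentIn hx⟩, hne_univ⟩
  have hyK : y ∈ K :=
    notMem_compl_iff.1 (frontier_connectedComponentIn_subset_compl hclosed.isOpen_compl x hy)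
  have hinsert : IsConnected (insert y (connectedComponentIn Kᶜ x)) :=
    ⟨insert_nonempty _ _, isPreconnected_connectedComponentIn.subset_closure (subset_insert _ _)
      (insert_subset hy.1 subset_closure)⟩
  have hunion := hK.union ⟨y, hyK, mem_insert _ _⟩ hinsert
  rwa [union_insert, insert_eq_of_mem (mem_union_left _ hyK)] at hunion

theorem forall_lt_or_forall_gt_of_isPreconnected {α : Type*} [LinearOrder α] [TopologicalSpace α]
    [OrderClosedTopology α] {s : Set X} (hs : IsPreconnected s) {f : X → α}
    (hf : ContinuousOn f s) {c : α} (hc : ∀ x ∈ s, f x ≠ c) :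
    (∀ x ∈ s, f x < c) ∨ (∀ x ∈ s, c < f x) := by
  by_contra! hcon
  obtain ⟨⟨x, hx, hcx⟩, ⟨y, hy, hyc⟩⟩ := hcon
  obtain ⟨z, hz, hzc⟩ := hs.intermediate_value hy hx hf ⟨hyc, hcx⟩
  exact hc z hz hzc

end Topology

theorem left_mem_extremePoints_segment {𝕜 E : Type*} [Field 𝕜] [LinearOrder 𝕜]
    [IsStrictOrderedRing 𝕜] [AddCommGroup E] [Module 𝕜 E] (p q : E) :
    p ∈ (segment 𝕜 p q).extremePoints 𝕜 := by
  refine mem_extremePoints_iff_left.2 ⟨left_mem_segment 𝕜 p q, ?_⟩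
  rw [segment_eq_image']
  rintro _ ⟨s, ⟨hs, -⟩, rfl⟩ _ ⟨t, ⟨ht, -⟩, rfl⟩ ⟨a, b, ha, hb, hab, hp⟩
  obtain rfl : b = 1 - a := by linarith
  have hzero : (a * s + (1 - a) * t) • (q - p) = 0 :=
    calc (a * s + (1 - a) * t) • (q - p)
      _ = a • (p + s • (q - p)) + (1 - a) • (p + t • (q - p)) - p := by module
      _ = 0 := sub_eq_zero.2 hp
  rcases smul_eq_zero.1 hzero with hst | hpq
  · have has : a * s = 0 := by linarith [mul_nonneg ha.le hs, mul_nonneg hb.le ht]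
    simp only [(mul_eq_zero.1 has).resolve_left ha.ne', zero_smul, add_zero]
  · simp only [hpq, smul_zero, add_zero]

theorem isConnected_segment {E : Type*} [AddCommGroup E] [Module ℝ E] [TopologicalSpace E]
    [IsTopologicalAddGroup E] [ContinuousSMul ℝ E] (p q : E) : IsConnected (segment ℝ p q) :=
  (convex_segment p q).isConnected ⟨p, left_mem_segment ℝ p q⟩

theorem isPartition_range_singleton (ι : Type*) :
    Setoid.IsPartition (range fun i : ι => ({i} : Set ι)) := by
  refine ⟨by simp, fun i => ⟨{i}, ⟨⟨i, rfl⟩, rfl⟩, ?_⟩⟩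
  rintro _ ⟨⟨j, rfl⟩, hj⟩
  rw [mem_singleton_iff.1 hj]

theorem isPartition_merge {ι : Type*} {c : Set (Set ι)} (hc : Setoid.IsPartition c)
    {S T : Set ι} (hS : S ∈ c) (hT : T ∈ c) :
    Setoid.IsPartition ((c \ {S, T}) ∪ {S ∪ T}) := by
  refine PairwiseDisjoint.isPartition_of_exists_of_ne_empty ?_ (fun i => ?_) ?_
  · rw [union_singleton]
    refine (hc.pairwiseDisjoint.subset sdiff_subset).insert fun U hU _ => ?_
    obtain ⟨hUS, hUT⟩ : U ≠ S ∧ U ≠ T := by simpa using hU.2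
    exact disjoint_union_left.2
      ⟨hc.pairwiseDisjoint hS hU.1 hUS.symm, hc.pairwiseDisjoint hT hU.1 hUT.symm⟩
  · obtain ⟨U, ⟨hU, hiU⟩, -⟩ := hc.2 i
    by_cases hUST : U ∈ ({S, T} : Set (Set ι))
    · refine ⟨S ∪ T, Or.inr rfl, ?_⟩
      rcases hUST with rfl | rfl
      exacts [Or.inl hiU, Or.inr hiU]
    · exact ⟨U, Or.inl ⟨hU, hUST⟩, hiU⟩
  · rintro (hempty | hempty)
    · exact hc.1 hempty.1
    · exact hc.1 ((union_empty_iff.1 hempty.symm).1 ▸ hS)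

namespace SimplePolygon

variable (Q : SimplePolygon)

theorem boundary_eq_iUnion_segment :
    Q.boundary = ⋃ i, segment ℝ (Q.poly.vertices i) (Q.poly.vertices (finRotate Q.n i)) := by
  simp only [boundary, Polygon.boundary, Polygon.edgeSet, affineSegment_eq_segment]

theorem isClosed_boundary : IsClosed Q.boundary := by
  rw [boundary_eq_iUnion_segment]
  refine isClosed_iUnion_of_finite fun i => ?_
  rw [← convexHull_pair]
  exact (toFinite _).isClosed_convexHull ℝ

theorem isConnected_boundary : IsConnected Q.boundary := by
  rw [boundary_eq_iUnion_segment]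
  obtain ⟨_ | m, hn, poly, -⟩ := Q
  · omega
  refine IsConnected.iUnion_of_chain (fun i => isConnected_segment _ _) fun i => ?_
  induction i using Fin.lastCases with
  | last =>
    rw [Fin.orderSucc_last, inter_self]
    exact ⟨_, left_mem_segment ℝ _ _⟩
  | cast i =>
    rw [Fin.orderSucc_castSucc]
    have hnext : finRotate (m + 1) i.castSucc = i.succ := by simp
    exact ⟨poly.vertices i.succ, hnext ▸ right_mem_segment ℝ _ _, left_mem_segment ℝ _ _⟩

theorem boundary_subset_region : Q.boundary ⊆ Q.region := subset_union_left

theorem connectedComponentIn_compl_boundary_subset_region {x : Plane} (hx : x ∈ Q.region) :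
    connectedComponentIn Q.boundaryᶜ x ⊆ Q.region := by
  rcases hx with hx | ⟨-, hbounded⟩
  · rw [connectedComponentIn_eq_empty (notMem_compl_iff.2 hx)]
    exact empty_subset _
  · intro y hy
    exact Or.inr ⟨connectedComponentIn_subset _ _ hy, connectedComponentIn_eq hy ▸ hbounded⟩

theorem region_sdiff_boundary_subset_interior : Q.region \ Q.boundary ⊆ interior Q.region :=
  fun _ hx => mem_interior.2 ⟨_, Q.connectedComponentIn_compl_boundary_subset_region hx.1,
    Q.isClosed_boundary.isOpen_compl.connectedComponentIn, mem_connectedComponentIn hx.2⟩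

theorem isConnected_region : IsConnected Q.region := by
  obtain ⟨a, ha⟩ := Q.isConnected_boundary.nonempty
  refine ⟨⟨a, Q.boundary_subset_region ha⟩, isPreconnected_of_forall a fun x hx => ?_⟩
  refine ⟨Q.boundary ∪ connectedComponentIn Q.boundaryᶜ x,
    union_subset Q.boundary_subset_region (Q.connectedComponentIn_compl_boundary_subset_region hx),
    Or.inl ha, or_iff_not_imp_left.2 fun hxb => mem_connectedComponentIn hxb, ?_⟩
  exact (isConnected_union_connectedComponentIn_compl Q.isConnected_boundary
    Q.isClosed_boundary x).isPreconnected

end SimplePolygon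

section Hulls

variable {ι : Type*} {P : ι → SimplePolygon} {S T : Set ι} {i : ι}

theorem region_subset_polyUnion (hi : i ∈ S) : (P i).region ⊆ polyUnion P S :=
  subset_biUnion_of_mem (u := fun i => (P i).region) hi

theorem polyUnion_subset_hull : polyUnion P S ⊆ hull P S :=
  subset_convexHull ℝ _

theorem hull_mono (h : S ⊆ T) : hull P S ⊆ hull P T :=
  convexHull_mono (biUnion_subset_biUnion_left h)

theorem exists_mem_boundary_of_mem_extremePoints_hull {p : Plane}
    (hp : p ∈ (hull P S).extremePoints ℝ) : ∃ i ∈ S, p ∈ (P i).boundary := by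
  obtain ⟨i, hi, hpi⟩ := mem_iUnion₂.1 (extremePoints_convexHull_subset hp)
  refine ⟨i, hi, by_contra fun hboundary => ?_⟩
  have hint : p ∈ interior (hull P S) :=
    interior_mono ((region_subset_polyUnion hi).trans polyUnion_subset_hull)
      ((P i).region_sdiff_boundary_subset_interior ⟨hpi, hboundary⟩)
  exact disjoint_left.1 (disjoint_interior_extremePoints (hull P S)) hint hp

theorem IsHullEdge.exists_mem_boundary {p q : Plane} (hpq : IsHullEdge (hull P S) p q) :
    ∃ i ∈ S, p ∈ (P i).boundary :=
  exists_mem_boundary_of_mem_extremePoints_hull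
    (hpq.2.extremePoints_subset_extremePoints (left_mem_extremePoints_segment p q))

end Hulls

section Tightness

variable {ι : Type*} {P : ι → SimplePolygon} {S T : Set ι} {a : Plane} {c : ℝ}

theorem tight_singleton (P : ι → SimplePolygon) (i : ι) : Tight P {i} := by
  rintro ⟨a, c, -, -, ⟨j, rfl, hlt⟩, ⟨k, rfl, hgt⟩⟩
  obtain ⟨x, hx⟩ := (P k).isConnected_region.nonempty
  exact lt_asymm (hlt x hx) (hgt x hx)

theorem Tight.hull_subset_halfSpace (hS : Tight P S) (ha : a ≠ 0)
    (hmiss : ∀ i ∈ S, ∀ x ∈ (P i).region, inner ℝ a x ≠ c) :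
    hull P S ⊆ {x | inner ℝ a x < c} ∨ hull P S ⊆ {x | c < inner ℝ a x} := by
  have hside : ∀ i ∈ S, (P i).region ⊆ {x | inner ℝ a x < c} ∨
      (P i).region ⊆ {x | c < inner ℝ a x} := fun i hi =>
    forall_lt_or_forall_gt_of_isPreconnected (P i).isConnected_region.isPreconnected
      (by fun_prop) (hmiss i hi)
  have hlin : IsLinearMap ℝ fun x : Plane => inner ℝ a x :=
    (innerₛₗ ℝ a).isLinear
  by_cases hlt : ∃ i ∈ S, (P i).region ⊆ {x | inner ℝ a x < c}
  · refine Or.inl (convexHull_min (iUnion₂_subset fun j hj => ?_) (convex_halfSpace_lt hlin c))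
    exact (hside j hj).resolve_right fun hgt => hS ⟨a, c, ha, hmiss, hlt, j, hj, hgt⟩
  · refine Or.inr (convexHull_min (iUnion₂_subset fun j hj => ?_) (convex_halfSpace_gt hlin c))
    exact (hside j hj).resolve_left fun hj' => hlt ⟨j, hj, hj'⟩

theorem Tight.inner_lt_iff_inner_lt (hS : Tight P S) (ha : a ≠ 0)
    (hmiss : ∀ i ∈ S, ∀ x ∈ (P i).region, inner ℝ a x ≠ c) {x y : Plane}
    (hx : x ∈ hull P S) (hy : y ∈ hull P S) : inner ℝ a x < c ↔ inner ℝ a y < c := by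
  rcases hS.hull_subset_halfSpace ha hmiss with hlt | hgt
  · exact iff_of_true (hlt hx) (hlt hy)
  · exact iff_of_false (hgt hx).not_gt (hgt hy).not_gt

theorem Tight.union (hS : Tight P S) (hT : Tight P T)
    (hST : (hull P S ∩ hull P T).Nonempty) : Tight P (S ∪ T) := by
  rintro ⟨a, c, ha, hmiss, ⟨i, hi, hlt⟩, ⟨j, hj, hgt⟩⟩
  obtain ⟨x, hxS, hxT⟩ := hST
  have hside : ∀ l ∈ S ∪ T, ∀ y ∈ (P l).region, inner ℝ a y < c ↔ inner ℝ a x < c := by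
    rintro l (hl | hl) y hy
    · exact hS.inner_lt_iff_inner_lt ha (fun i hi => hmiss i (Or.inl hi))
        (polyUnion_subset_hull (region_subset_polyUnion hl hy)) hxS
    · exact hT.inner_lt_iff_inner_lt ha (fun i hi => hmiss i (Or.inr hi))
        (polyUnion_subset_hull (region_subset_polyUnion hl hy)) hxT
  obtain ⟨y, hy⟩ := (P i).isConnected_region.nonempty
  obtain ⟨z, hz⟩ := (P j).isConnected_region.nonempty
  exact lt_asymm (hgt z hz) ((hside j hj z hz).2 ((hside i hi y hy).1 (hlt y hy)))

end Tightness

section Bridges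

variable {ι : Type*} {P : ι → SimplePolygon} {S T : Set ι} {B C : Set (Plane × Plane)}

/-- The polygons with index in `S` together with the segments in `B`: the set that has to be
connected for `S` to be bridgeable by `B`. -/
def bridgedUnion (P : ι → SimplePolygon) (S : Set ι) (B : Set (Plane × Plane)) : Set Plane :=
  polyUnion P S ∪ ⋃ b ∈ B, segment ℝ b.1 b.2

theorem region_subset_bridgedUnion {i : ι} (hi : i ∈ S) : (P i).region ⊆ bridgedUnion P S B :=
  (region_subset_polyUnion hi).trans subset_union_left

theorem segment_subset_bridgedUnion {b : Plane × Plane} (hb : b ∈ B) :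
    segment ℝ b.1 b.2 ⊆ bridgedUnion P S B :=
  (subset_biUnion_of_mem (u := fun b : Plane × Plane => segment ℝ b.1 b.2) hb).trans
    subset_union_right

theorem openSegment_subset_bridgedUnion {b : Plane × Plane} (hb : b ∈ B) :
    openSegment ℝ b.1 b.2 ⊆ bridgedUnion P S B :=
  (openSegment_subset_segment ℝ _ _).trans (segment_subset_bridgedUnion hb)

theorem bridgedUnion_insert_union (b : Plane × Plane) :
    bridgedUnion P (S ∪ T) (insert b (B ∪ C)) =
      bridgedUnion P S B ∪ segment ℝ b.1 b.2 ∪ bridgedUnion P T C := by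
  simp only [bridgedUnion, polyUnion, biUnion_union, biUnion_insert]
  ac_rfl

theorem bridgeableBy_singleton_empty (P : ι → SimplePolygon) (i : ι) : BridgeableBy P {i} ∅ where
  finite := finite_empty
  nondegenerate := by simp
  interior_disjoint := by simp
  connected := by simpa [polyUnion] using (P i).isConnected_region
  interior_disjoint_polygon := by simp
  mem_of_meets := by simp
  endpoint := by simp
  subset_hull := by simp

theorem BridgeableBy.bridgedUnion_subset_hull (hS : BridgeableBy P S B) :
    bridgedUnion P S B ⊆ hull P S :=
  union_subset polyUnion_subset_hull (iUnion₂_subset hS.subset_hull)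

theorem BridgeableBy.insert_union (hS : BridgeableBy P S B) (hT : BridgeableBy P T C)
    (hBC : (B ∪ C).PairwiseDisjoint fun b => openSegment ℝ b.1 b.2) {p q : Plane} (hpq : p ≠ q)
    (hp : ∃ i ∈ S, p ∈ (P i).boundary) (hq : q ∈ bridgedUnion P T C)
    (hclear : ∀ b ∈ B ∪ C, Disjoint (openSegment ℝ p q) (openSegment ℝ b.1 b.2))
    (hinterior : ∀ i, Disjoint (openSegment ℝ p q) (interior (P i).region))
    (hmeets : ∀ i, (segment ℝ p q ∩ (P i).region).Nonempty → i ∈ S ∪ T)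
    (hhull : segment ℝ p q ⊆ hull P (S ∪ T)) :
    BridgeableBy P (S ∪ T) (insert (p, q) (B ∪ C)) where
  finite := (hS.finite.union hT.finite).insert _
  nondegenerate := by
    rintro b (rfl | hb | hb)
    exacts [hpq, hS.nondegenerate b hb, hT.nondegenerate b hb]
  interior_disjoint := hBC.insert fun b hb _ => hclear b hb
  connected := by
    obtain ⟨i, hi, hpi⟩ := hp
    have hpS : p ∈ bridgedUnion P S B :=
      region_subset_bridgedUnion hi ((P i).boundary_subset_region hpi)
    change IsConnected (bridgedUnion P (S ∪ T) (insert (p, q) (B ∪ C)))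
    rw [bridgedUnion_insert_union]
    exact (IsConnected.union ⟨p, hpS, left_mem_segment ℝ p q⟩ hS.connected
      (isConnected_segment p q)).union ⟨q, Or.inr (right_mem_segment ℝ p q), hq⟩ hT.connected
  interior_disjoint_polygon := by
    rintro b (rfl | hb | hb)
    exacts [hinterior, hS.interior_disjoint_polygon b hb, hT.interior_disjoint_polygon b hb]
  mem_of_meets := by
    rintro b (rfl | hb | hb) i hi
    exacts [hmeets i hi, Or.inl (hS.mem_of_meets b hb i hi), Or.inr (hT.mem_of_meets b hb i hi)]
  endpoint := by
    rintro b (rfl | hb | hb)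
    · exact hp.imp fun i hi => ⟨Or.inl hi.1, Or.inl hi.2⟩
    · exact (hS.endpoint b hb).imp fun i hi => ⟨Or.inl hi.1, hi.2⟩
    · exact (hT.endpoint b hb).imp fun i hi => ⟨Or.inr hi.1, hi.2⟩
  subset_hull := by
    rintro b (rfl | hb | hb)
    exacts [hhull, (hS.subset_hull b hb).trans (hull_mono subset_union_left),
      (hT.subset_hull b hb).trans (hull_mono subset_union_right)]

end Bridges

namespace State

variable {ι : Type*} (s : State ι) (S T : Set ι) {τ : Trace ι} {queue : List (Sym2 Plane)}

/-- The state after an iteration in which the trace `τ` joins the sets `S` and `T` of the partition.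
An iteration without a merge is the case `S = T`. -/
def join (τ : Trace ι) (queue : List (Sym2 Plane)) : State ι :=
  ⟨(s.part \ {S, T}) ∪ {S ∪ T}, insert τ s.traces, queue⟩

variable {S} in
theorem join_self (hS : S ∈ s.part) : s.join S S τ queue = ⟨s.part, insert τ s.traces, queue⟩ := by
  rw [join, pair_eq_singleton, union_self, sdiff_union_of_subset (singleton_subset_iff.2 hS)]

theorem segmentsOf_union : s.segmentsOf (S ∪ T) = s.segmentsOf S ∪ s.segmentsOf T := by
  ext b
  simp only [segmentsOf, mem_union, mem_ofPred_eq, or_and_right, and_or_left, exists_or]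

variable {U : Set ι}

theorem segmentsOf_join_of_mem (hτ : τ.label ∈ U) :
    (s.join S T τ queue).segmentsOf U = insert (τ.src, τ.dst) (s.segmentsOf U) := by
  ext b
  simp [join, segmentsOf, hτ]

theorem segmentsOf_join_of_notMem (hτ : τ.label ∉ U) :
    (s.join S T τ queue).segmentsOf U = s.segmentsOf U := by
  ext b
  simp [join, segmentsOf, hτ]

theorem bridgedUnion_subset_scene (P : ι → SimplePolygon) :
    bridgedUnion P S (s.segmentsOf S) ⊆ scene P s := by
  refine union_subset_union (iUnion₂_subset fun i _ => subset_iUnion (fun i => (P i).region) i)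
    (iUnion₂_subset ?_)
  rintro _ ⟨τ, hτ, -, rfl⟩
  exact subset_biUnion_of_mem (u := fun τ : Trace ι => segment ℝ τ.src τ.dst) hτ

end State

section MainLoop

variable {ι : Type*} {P : ι → SimplePolygon} {s : State ι} {X Y : Set ι} {p q h : Plane} {i k : ι}

/-- The invariant of the main loop: the blocks of the partition are tight, and each is bridged by
the traces shot from it, the resulting bridged unions being pairwise disjoint. A queued edge is
only required to be an edge of the hull of some part of a block, since a merge may destroy hull
edges. -/
structure Invariant (P : ι → SimplePolygon) (s : State ι) : Prop where
  isPartition : Setoid.IsPartition s.part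
  tight : ∀ S ∈ s.part, Tight P S
  bridgeableBy : ∀ S ∈ s.part, BridgeableBy P S (s.segmentsOf S)
  disjoint : s.part.PairwiseDisjoint fun S => bridgedUnion P S (s.segmentsOf S)
  isHullEdge : ∀ p q, s(p, q) ∈ s.queue → ∃ S ∈ s.part, ∃ T ⊆ S, IsHullEdge (hull P T) p q

/-- The ray that is shot in state `s` from the point `p` of the polygon `i` along the queued edge
`s(p, q)` joins the set `X` of the partition to the set `Y`, which may be `X` itself. -/
structure Joins (P : ι → SimplePolygon) (s : State ι) (X Y : Set ι) (p q h : Plane) (i k : ι) :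
    Prop extends Shoots P s p q h i k where
  mem_queue : s(p, q) ∈ s.queue
  left_mem : X ∈ s.part
  right_mem : Y ∈ s.part
  source_mem : i ∈ X
  target_mem : k ∈ Y

theorem Shoots.mem_bridgedUnion (hs : Shoots P s p q h i k) (hk : k ∈ Y) :
    h ∈ bridgedUnion P Y (s.segmentsOf Y) := by
  rcases hs.hit with ⟨rfl, hq⟩ | ⟨-, hh | ⟨τ, hτ, hh, rfl⟩⟩
  · exact region_subset_bridgedUnion hk hq
  · exact region_subset_bridgedUnion hk hh
  · have hτY : (τ.src, τ.dst) ∈ s.segmentsOf Y := ⟨τ, hτ, hk, rfl⟩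
    exact segment_subset_bridgedUnion hτY hh

theorem IsInitial.invariant (hdisj : Pairwise fun i j => Disjoint (P i).region (P j).region)
    (hs : IsInitial P s) : Invariant P s := by
  have hseg : ∀ S, s.segmentsOf S = ∅ := fun S => by simp [State.segmentsOf, hs.traces_eq]
  constructor
  · exact hs.part_eq ▸ isPartition_range_singleton ι
  · rw [hs.part_eq]
    exact forall_mem_range.2 (tight_singleton P)
  · simp only [hs.part_eq, hseg]
    exact forall_mem_range.2 (bridgeableBy_singleton_empty P)
  · rw [hs.part_eq]
    rintro _ ⟨i, rfl⟩ _ ⟨j, rfl⟩ hij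
    simpa [Function.onFun, bridgedUnion, polyUnion, hseg] using hdisj (ne_of_apply_ne _ hij)
  · intro p q hpq
    obtain ⟨i, hi, -⟩ := (hs.mem_queue p q).1 hpq
    exact ⟨{i}, hs.part_eq ▸ mem_range_self i, {i}, Subset.rfl, hi⟩

namespace Invariant

theorem proper (hinv : Invariant P s) : Proper P s.part :=
  ⟨hinv.isPartition, fun S hS => ⟨hinv.tight S hS, _, hinv.bridgeableBy S hS⟩⟩

theorem exists_isHullEdge_hull (hinv : Invariant P s) (hpq : s(p, q) ∈ s.queue)
    (hp : p ∈ (P i).region) (hX : X ∈ s.part) (hi : i ∈ X) :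
    ∃ T ⊆ X, IsHullEdge (hull P T) p q := by
  obtain ⟨S, hS, T, hTS, hedge⟩ := hinv.isHullEdge p q hpq
  obtain ⟨j, hj, hpj⟩ := hedge.exists_mem_boundary
  have hSX : S = X := hinv.disjoint.elim_set hS hX p
    (region_subset_bridgedUnion (hTS hj) ((P j).boundary_subset_region hpj))
    (region_subset_bridgedUnion hi hp)
  exact ⟨T, hSX ▸ hTS, hedge⟩

theorem exists_isHullEdge_join (hinv : Invariant P s) {τ : Trace ι} {queue : List (Sym2 Plane)}
    (hpq : s(p, q) ∈ s.queue) :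
    ∃ S ∈ (s.join X Y τ queue).part, ∃ T ⊆ S, IsHullEdge (hull P T) p q := by
  obtain ⟨S, hS, T, hTS, hedge⟩ := hinv.isHullEdge p q hpq
  by_cases hSXY : S ∈ ({X, Y} : Set (Set ι))
  · refine ⟨X ∪ Y, Or.inr rfl, T, hTS.trans ?_, hedge⟩
    rcases hSXY with rfl | rfl
    exacts [subset_union_left, subset_union_right]
  · exact ⟨S, Or.inl ⟨hS, hSXY⟩, T, hTS, hedge⟩

theorem pairwiseDisjoint_openSegment (hinv : Invariant P s) (hX : X ∈ s.part) (hY : Y ∈ s.part) :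
    (s.segmentsOf X ∪ s.segmentsOf Y).PairwiseDisjoint fun b => openSegment ℝ b.1 b.2 := by
  obtain rfl | hXY := eq_or_ne X Y
  · rw [union_self]
    exact (hinv.bridgeableBy X hX).interior_disjoint
  · exact PairwiseDisjoint.union (hinv.bridgeableBy X hX).interior_disjoint
      (hinv.bridgeableBy Y hY).interior_disjoint fun b hb c hc _ =>
        (hinv.disjoint hX hY hXY).mono (openSegment_subset_bridgedUnion hb)
          (openSegment_subset_bridgedUnion hc)

end Invariant

namespace Joins

theorem exists_mem_boundary (hjoin : Joins P s X Y p q h i k) (hinv : Invariant P s) :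
    ∃ j ∈ X, p ∈ (P j).boundary := by
  obtain ⟨T, hTX, hedge⟩ := hinv.exists_isHullEdge_hull hjoin.mem_queue hjoin.source
    hjoin.left_mem hjoin.source_mem
  obtain ⟨j, hj, hpj⟩ := hedge.exists_mem_boundary
  exact ⟨j, hTX hj, hpj⟩

theorem segment_subset_hull (hjoin : Joins P s X Y p q h i k) (hinv : Invariant P s) :
    segment ℝ p h ⊆ hull P X := by
  obtain ⟨T, hTX, hedge⟩ := hinv.exists_isHullEdge_hull hjoin.mem_queue hjoin.source
    hjoin.left_mem hjoin.source_mem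
  calc segment ℝ p h ⊆ segment ℝ p q :=
        (convex_segment p q).segment_subset (left_mem_segment ℝ p q) hjoin.mem_segment
    _ ⊆ hull P T := hedge.2.subset
    _ ⊆ hull P X := hull_mono hTX

theorem hull_inter_hull_nonempty (hjoin : Joins P s X Y p q h i k) (hinv : Invariant P s) :
    (hull P X ∩ hull P Y).Nonempty :=
  ⟨h, hjoin.segment_subset_hull hinv (right_mem_segment ℝ p h),
    (hinv.bridgeableBy Y hjoin.right_mem).bridgedUnion_subset_hull
      (hjoin.mem_bridgedUnion hjoin.target_mem)⟩

theorem disjoint_segment_bridgedUnion (hjoin : Joins P s X Y p q h i k) (hinv : Invariant P s)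
    {T : Set ι} (hT : T ∈ s.part) (hTX : T ≠ X) (hTY : T ≠ Y) :
    Disjoint (segment ℝ p h) (bridgedUnion P T (s.segmentsOf T)) := by
  have hp : p ∈ bridgedUnion P X (s.segmentsOf X) :=
    region_subset_bridgedUnion hjoin.source_mem hjoin.source
  have hh := hjoin.mem_bridgedUnion hjoin.target_mem
  rw [← insert_endpoints_openSegment, disjoint_insert_left, disjoint_insert_left]
  exact ⟨disjoint_left.1 (hinv.disjoint hjoin.left_mem hT hTX.symm) hp,
    disjoint_left.1 (hinv.disjoint hjoin.right_mem hT hTY.symm) hh,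
    hjoin.clear.mono_right (s.bridgedUnion_subset_scene T P)⟩

theorem mem_union_of_meets (hjoin : Joins P s X Y p q h i k) (hinv : Invariant P s) {j : ι}
    (hj : (segment ℝ p h ∩ (P j).region).Nonempty) : j ∈ X ∪ Y := by
  obtain ⟨T, ⟨hT, hjT⟩, -⟩ := hinv.isPartition.2 j
  by_contra hjXY
  refine (hj.mono (inter_subset_inter_right _ (region_subset_bridgedUnion hjT))).not_disjoint
    (hjoin.disjoint_segment_bridgedUnion hinv hT ?_ ?_)
  · rintro rfl
    exact hjXY (Or.inl hjT)
  · rintro rfl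
    exact hjXY (Or.inr hjT)

theorem bridgeableBy_union (hjoin : Joins P s X Y p q h i k) (hinv : Invariant P s) :
    BridgeableBy P (X ∪ Y) (insert (p, h) (s.segmentsOf X ∪ s.segmentsOf Y)) := by
  refine (hinv.bridgeableBy X hjoin.left_mem).insert_union (hinv.bridgeableBy Y hjoin.right_mem)
    (hinv.pairwiseDisjoint_openSegment hjoin.left_mem hjoin.right_mem) hjoin.ne_source.symm
    (hjoin.exists_mem_boundary hinv) (hjoin.mem_bridgedUnion hjoin.target_mem) (fun b hb => ?_)
    (fun j => ?_) (fun j => hjoin.mem_union_of_meets hinv)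
    ((hjoin.segment_subset_hull hinv).trans (hull_mono subset_union_left))
  · rw [← s.segmentsOf_union] at hb
    exact hjoin.clear.mono_right
      ((openSegment_subset_bridgedUnion hb).trans (s.bridgedUnion_subset_scene (X ∪ Y) P))
  · exact hjoin.clear.mono_right (interior_subset.trans
      ((region_subset_bridgedUnion (mem_univ j)).trans (s.bridgedUnion_subset_scene univ P)))

theorem compatible (hjoin : Joins P s X Y p q h i k) (hinv : Invariant P s) (hXY : X ≠ Y) :
    Compatible P X Y := by
  refine ⟨hinv.isPartition.pairwiseDisjoint hjoin.left_mem hjoin.right_mem hXY, ?_,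
    _, hjoin.bridgeableBy_union hinv⟩
  exact ⟨_, _, hinv.bridgeableBy X hjoin.left_mem, hinv.bridgeableBy Y hjoin.right_mem,
    fun b hb c hc => (hinv.disjoint hjoin.left_mem hjoin.right_mem hXY).mono
      (segment_subset_bridgedUnion hb) (segment_subset_bridgedUnion hc)⟩

variable {queue : List (Sym2 Plane)}

theorem segmentsOf_join_union (hjoin : Joins P s X Y p q h i k) :
    (s.join X Y ⟨p, h, i⟩ queue).segmentsOf (X ∪ Y) =
      insert (p, h) (s.segmentsOf X ∪ s.segmentsOf Y) := by
  rw [s.segmentsOf_join_of_mem X Y (Or.inl hjoin.source_mem), s.segmentsOf_union]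

theorem segmentsOf_join (hjoin : Joins P s X Y p q h i k) (hinv : Invariant P s) {S : Set ι}
    (hS : S ∈ s.part \ {X, Y}) :
    (s.join X Y ⟨p, h, i⟩ queue).segmentsOf S = s.segmentsOf S :=
  s.segmentsOf_join_of_notMem X Y fun hi => hS.2 <| Or.inl <|
    hinv.isPartition.pairwiseDisjoint.elim_set hS.1 hjoin.left_mem i hi hjoin.source_mem

theorem pairwiseDisjoint_bridgedUnion (hjoin : Joins P s X Y p q h i k) (hinv : Invariant P s) :
    (s.join X Y ⟨p, h, i⟩ queue).part.PairwiseDisjoint fun S =>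
      bridgedUnion P S ((s.join X Y ⟨p, h, i⟩ queue).segmentsOf S) := by
  have hpart : (s.join X Y ⟨p, h, i⟩ queue).part = insert (X ∪ Y) (s.part \ {X, Y}) :=
    union_singleton
  rw [hpart]
  refine PairwiseDisjoint.insert (fun S hS T hT hST => ?_) fun S hS _ => ?_
  · simpa only [Function.onFun, hjoin.segmentsOf_join hinv hS, hjoin.segmentsOf_join hinv hT]
      using hinv.disjoint hS.1 hT.1 hST
  · obtain ⟨hSX, hSY⟩ : S ≠ X ∧ S ≠ Y := by simpa using hS.2
    rw [hjoin.segmentsOf_join hinv hS, hjoin.segmentsOf_join_union, bridgedUnion_insert_union]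
    simp only [disjoint_union_left]
    exact ⟨⟨hinv.disjoint hjoin.left_mem hS.1 hSX.symm,
      hjoin.disjoint_segment_bridgedUnion hinv hS.1 hSX hSY⟩,
      hinv.disjoint hjoin.right_mem hS.1 hSY.symm⟩

theorem invariant_join (hjoin : Joins P s X Y p q h i k) (hinv : Invariant P s)
    (hqueue : ∀ a b, s(a, b) ∈ queue → s(a, b) ∈ s.queue ∨ IsHullEdge (hull P (X ∪ Y)) a b) :
    Invariant P (s.join X Y ⟨p, h, i⟩ queue) := by
  constructor
  · exact isPartition_merge hinv.isPartition hjoin.left_mem hjoin.right_mem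
  · rintro S (hS | rfl)
    · exact hinv.tight S hS.1
    · exact (hinv.tight X hjoin.left_mem).union (hinv.tight Y hjoin.right_mem)
        (hjoin.hull_inter_hull_nonempty hinv)
  · rintro S (hS | rfl)
    · rw [hjoin.segmentsOf_join hinv hS]
      exact hinv.bridgeableBy S hS.1
    · rw [hjoin.segmentsOf_join_union]
      exact hjoin.bridgeableBy_union hinv
  · exact hjoin.pairwiseDisjoint_bridgedUnion hinv
  · intro a b hab
    rcases hqueue a b hab with hold | hnew
    · exact hinv.exists_isHullEdge_join hold
    · exact ⟨X ∪ Y, Or.inr rfl, X ∪ Y, Subset.rfl, hnew⟩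

end Joins

theorem MergeStep.exists_joins {s' : State ι} (hstep : MergeStep P s X Y s') :
    ∃ p q h i k queue, Joins P s X Y p q h i k ∧ X ≠ Y ∧
      s' = s.join X Y ⟨p, h, i⟩ queue ∧
      ∀ a b, s(a, b) ∈ queue → s(a, b) ∈ s.queue ∨ IsHullEdge (hull P (X ∪ Y)) a b := by
  obtain ⟨p, q, h, i, k, rest, new, hqueue, hs, hX, hY, hi, hk, hXY, -, hnew, rfl⟩ := hstep
  refine ⟨p, q, h, i, k, rest ++ new, ⟨hs, hqueue ▸ List.mem_cons_self, hX, hY, hi, hk⟩, hXY, rfl,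
    fun a b hab => (List.mem_append.1 hab).imp (fun hrest => ?_) fun h => ((hnew a b).1 h).1⟩
  exact hqueue ▸ List.mem_cons_of_mem _ hrest

theorem IdleStep.exists_joins {s' : State ι} (hstep : IdleStep P s s') :
    ∃ X p q h i k queue, Joins P s X X p q h i k ∧
      s' = s.join X X ⟨p, h, i⟩ queue ∧ queue ⊆ s.queue := by
  obtain ⟨p, q, h, i, k, rest, hqueue, hs, ⟨X, hX, hi, hk⟩, rfl⟩ := hstep
  exact ⟨X, p, q, h, i, k, rest, ⟨hs, hqueue ▸ List.mem_cons_self, hX, hX, hi, hk⟩,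
    (s.join_self hX).symm, hqueue ▸ List.subset_cons_self _ _⟩

namespace Invariant

theorem idleStep {s' : State ι} (hinv : Invariant P s) (hstep : IdleStep P s s') :
    Invariant P s' := by
  obtain ⟨X, p, q, h, i, k, queue, hjoin, rfl, hqueue⟩ := hstep.exists_joins
  exact hjoin.invariant_join hinv fun a b hab => Or.inl (hqueue hab)

theorem mergeStep {s' : State ι} (hinv : Invariant P s) (hstep : MergeStep P s X Y s') :
    Invariant P s' := by
  obtain ⟨p, q, h, i, k, queue, hjoin, -, rfl, hqueue⟩ := hstep.exists_joins
  exact hjoin.invariant_join hinv hqueue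

theorem reflTransGen_idleStep {s' : State ι} (hinv : Invariant P s)
    (hsteps : Relation.ReflTransGen (IdleStep P) s s') : Invariant P s' := by
  induction hsteps with
  | refl => exact hinv
  | tail _ hstep ih => exact ih.idleStep hstep

end Invariant

namespace Execution

variable {m t : ℕ} (E : Execution P m)

theorem invariant_start (hdisj : Pairwise fun i j => Disjoint (P i).region (P j).region)
    (ht : t ≤ m) : Invariant P (E.start t) := by
  induction t with
  | zero => exact E.initial.invariant hdisj
  | succ t ih =>
    exact ((ih (by lia)).reflTransGen_idleStep (E.idle t ht)).mergeStep (E.merge t ht)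

theorem invariant_finish (hdisj : Pairwise fun i j => Disjoint (P i).region (P j).region)
    (ht : t < m) : Invariant P (E.finish t) :=
  (E.invariant_start hdisj ht.le).reflTransGen_idleStep (E.idle t ht)

end Execution

end MainLoop

end Convexify

theorem mainTheorem6_general {ι : Type*} (P : ι → SimplePolygon)
    (hdisj : Pairwise fun i j => Disjoint (P i).region (P j).region)
    (m : ℕ) (E : Execution P m) :
    (∀ t < m,
      (hull P (E.left t) ∩ hull P (E.right t)).Nonempty ∧
      Compatible P (E.left t) (E.right t) ∧
      Proper P (E.partition (t + 1))) ∧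
    Proper P (E.partition 0) ∧
    (∀ t ≤ m, ∀ S ∈ E.partition t, BridgeableBy P S ((E.start t).segmentsOf S)) := by
  refine ⟨fun t ht => ?_, (E.invariant_start hdisj m.zero_le).proper,
    fun t ht => (E.invariant_start hdisj ht).bridgeableBy⟩
  have hinv := E.invariant_finish hdisj ht
  obtain ⟨p, q, h, i, k, queue, hjoin, hne, -, -⟩ := (E.merge t ht).exists_joins
  exact ⟨hjoin.hull_inter_hull_nonempty hinv, hjoin.compatible hinv hne,
    (E.invariant_start hdisj ht).proper⟩

theorem mainTheorem6 {ι : Type*} [Finite ι] (P : ι → SimplePolygon)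
    (hdisj : Pairwise fun i j => Disjoint (P i).region (P j).region)
    (hgen : GeneralPosition P) (m : ℕ) (E : Execution P m) :
    (∀ t < m,
      (hull P (E.left t) ∩ hull P (E.right t)).Nonempty ∧
      Compatible P (E.left t) (E.right t) ∧
      Proper P (E.partition (t + 1))) ∧
    Proper P (E.partition 0) ∧
    (∀ t ≤ m, ∀ S ∈ E.partition t, BridgeableBy P S ((E.start t).segmentsOf S)) :=
  mainTheorem6_general P hdisj m E
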